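/- Let $n\ge 2$. A state is a positive semidefinite $n\times n$ complex matrix $\rho$ with $\operatorname{Tr}\rho=1$; it is pure if it has rank one. Its purity is $P(\rho)=\operatorname{Tr}[\rho^2]/\operatorname{Tr}[\rho]^2$. The subentropy of $\rho$ with eigenvalues $\lambda_1,\dots,\lambda_n$ is $$Q(\rho)=-\sum_{k=1}^n\frac{\lambda_k^n\ln\lambda_k}{\prod_{j\ne k}(\lambda_k-\lambda_j)},$$ where in case of null or repeated eigenvalues the right-hand side is read as its limit along vectors of pairwise distinct positive numbers tending to $(\lambda_1,\dots,\lambda_n)$; this limit exists for every state. Put $\mathcal D_\epsilon(X)=\epsilon X+(1-\epsilon)\operatorname{Tr}[X]\,\mathbb 1/n$ and $\Sigma_k=\sum_{j=2}^k 1/j$. Let $1/n\le P\le 1$ and $$\epsilon=\sqrt{\frac{nP-1}{n-1}},\qquad a=\frac{1-\epsilon}{n},\qquad b=\epsilon+\frac{1-\epsilon}{n}.$$ For every pure state $\phi$, the matrix $\mathcal D_\epsilon(\phi)$ is a state of purity $P$ with eigenvalues $a$ (multiplicity $n-1$) and $b$ (multiplicity $1$) (for $P=1/n$ one has $a=b$),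 and it maximises $Q$ among all states of purity $P$. If $P>1/n$, the maximum is $$\max_{\rho:\,P(\rho)=P}Q(\rho)=\sum_{k=2}^n\binom nk\frac{a^k(\ln a-\Sigma_k)}{(b-a)^{k-1}}-\frac{b^n(\ln b-\Sigma_n)}{(b-a)^{n-1}}-\Sigma_n,$$ with $0^k\ln 0=0$ when $P=1$. If $P=1/n$, the maximum is $\ln n-\Sigma_n$, which is the limit of this expression as $P\downarrow 1/n$. -/

import Mathlib

open Filter Topology
open scoped ComplexOrder

noncomputable section

namespace QState

/-- A quantum state on `ℂⁿ`: a positive semidefinite matrix of trace one. -/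
def IsState {n : ℕ} (ρ : Matrix (Fin n) (Fin n) ℂ) : Prop :=
  ρ.PosSemidef ∧ ρ.trace = 1

/-- A pure state: a state of rank one. -/
def IsPureState {n : ℕ} (φ : Matrix (Fin n) (Fin n) ℂ) : Prop :=
  IsState φ ∧ φ.rank = 1

/-- The purity `Tr[X²] / Tr[X]²` of a self-adjoint matrix (both traces are real). -/
def purity {n : ℕ} (X : Matrix (Fin n) (Fin n) ℂ) : ℝ :=
  (X * X).trace.re / X.trace.re ^ 2

/-- The depolarizing map `X ↦ ε X + (1 - ε) Tr[X] 𝟙 / n`. -/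
def depolarize {n : ℕ} (ε : ℝ) (X : Matrix (Fin n) (Fin n) ℂ) : Matrix (Fin n) (Fin n) ℂ :=
  (ε : ℂ) • X + ((1 - (ε : ℂ)) * X.trace / (n : ℂ)) • (1 : Matrix (Fin n) (Fin n) ℂ)

/-- The spectra without null entries and without degeneracies. -/
def genericSpectra (n : ℕ) : Set (Fin n → ℝ) :=
  {l | (∀ k, 0 < l k) ∧ Function.Injective l}

/-- `- ∑ₖ λₖⁿ ln λₖ / ∏_{j ≠ k} (λₖ - λⱼ)`, the subentropy of a generic spectrum. -/
def genericSubentropy {n : ℕ} (l : Fin n → ℝ) : ℝ :=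
  -∑ k, l k ^ n * Real.log (l k) / ∏ j ∈ Finset.univ.erase k, (l k - l j)

/-- The subentropy of an arbitrary spectrum, as the limit along generic spectra. -/
def spectralSubentropy {n : ℕ} (l : Fin n → ℝ) : ℝ :=
  limUnder (𝓝[genericSpectra n] l) genericSubentropy

open Classical in
/-- The subentropy `Q(ρ)`, a function of the eigenvalues of `ρ` with their multiplicities
(only used for Hermitian `ρ`). -/
def subentropy {n : ℕ} (ρ : Matrix (Fin n) (Fin n) ℂ) : ℝ :=
  if h : ρ.IsHermitian then spectralSubentropy h.eigenvalues else 0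

/-- `Σₖ = ∑_{j=2}^k 1/j`. -/
def harmonicTail (k : ℕ) : ℝ := ∑ j ∈ Finset.Icc 2 k, 1 / (j : ℝ)

/-- `ε = √((nP - 1)/(n - 1))`. -/
def epsOf (n : ℕ) (P : ℝ) : ℝ := Real.sqrt ((n * P - 1) / (n - 1))

/-- `a = (1 - ε)/n`. -/
def eigA (n : ℕ) (P : ℝ) : ℝ := (1 - epsOf n P) / n

/-- `b = ε + (1 - ε)/n`. -/
def eigB (n : ℕ) (P : ℝ) : ℝ := epsOf n P + (1 - epsOf n P) / n

/-- The explicit expression for the maximal subentropy at purity `P`; it is meaningful for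
`1/n < P ≤ 1`, where `a < b` (at `P = 1` one has `a = 0`, and `aᵏ ln a` is zero). -/
def maxSubentropyFormula (n : ℕ) (P : ℝ) : ℝ :=
  (∑ k ∈ Finset.Icc 2 n, (n.choose k : ℝ) *
      (eigA n P ^ k * (Real.log (eigA n P) - harmonicTail k) / (eigB n P - eigA n P) ^ (k - 1)))
    - eigB n P ^ n * (Real.log (eigB n P) - harmonicTail n) / (eigB n P - eigA n P) ^ (n - 1)
    - harmonicTail n

/-- Every nonnegative spectrum is a limit of generic ones, so that the limit in
`spectralSubentropy` is unique where it exists. -/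
theorem genericSpectra_neBot {n : ℕ} (l : Fin n → ℝ) (hl : ∀ k, 0 ≤ l k) :
    (𝓝[genericSpectra n] l).NeBot := by
  rw [← mem_closure_iff_nhdsWithin_neBot]
  have hc : Tendsto (fun t : ℝ => fun k : Fin n => l k + t * ((k : ℕ) + 1 : ℝ)) (𝓝[>] 0) (𝓝 l) := by
    have : Continuous fun t : ℝ => fun k : Fin n => l k + t * ((k : ℕ) + 1 : ℝ) := by fun_prop
    simpa using (this.tendsto 0).mono_left nhdsWithin_le_nhds
  refine mem_closure_of_tendsto hc ?_
  have hinj : ∀ᶠ t : ℝ in 𝓝[>] 0, ∀ i j : Fin n, i ≠ j →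
      l i + t * ((i : ℕ) + 1 : ℝ) ≠ l j + t * ((j : ℕ) + 1 : ℝ) := by
    simp only [eventually_all]
    intro i j hij
    have hij' : ((i : ℕ) : ℝ) - ((j : ℕ) : ℝ) ≠ 0 := by
      rw [sub_ne_zero]
      exact fun h => hij (Fin.ext (by exact_mod_cast h))
    have h0 : ∀ᶠ t : ℝ in 𝓝[>] 0, t ≠ (l j - l i) / (((i : ℕ) : ℝ) - ((j : ℕ) : ℝ)) := by
      refine Filter.Eventually.filter_mono
        (nhdsWithin_mono (0 : ℝ) fun x (hx : 0 < x) => hx.ne') ?_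
      by_cases hz : (l j - l i) / (((i : ℕ) : ℝ) - ((j : ℕ) : ℝ)) = 0
      · rw [hz]
        exact eventually_mem_nhdsWithin
      · exact (isOpen_ne.eventually_mem (Ne.symm hz)).filter_mono nhdsWithin_le_nhds
    filter_upwards [h0] with t ht h
    exact ht (by rw [eq_div_iff hij']; linarith)
  filter_upwards [hinj, self_mem_nhdsWithin] with t h1 h2
  have h2' : 0 < t := h2
  refine ⟨fun k => ?_, fun i j h => ?_⟩
  · have := hl k
    positivity
  · by_contra hne
    exact h1 i j hne h

/-- On generic spectra the limit is the value of the formula. -/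
theorem spectralSubentropy_eq {n : ℕ} (l : Fin n → ℝ) (hl : l ∈ genericSpectra n) :
    spectralSubentropy l = genericSubentropy l := by
  have := genericSpectra_neBot l fun k => (hl.1 k).le
  refine Tendsto.limUnder_eq (ContinuousAt.continuousWithinAt ?_)
  unfold genericSubentropy
  refine ContinuousAt.neg (tendsto_finsetSum _ fun k _ => ?_)
  have hk : ∀ j, ContinuousAt (fun x : Fin n → ℝ => x j) l :=
    fun j => (continuous_apply j).continuousAt
  refine ContinuousAt.div (((hk k).pow n).mul ((hk k).log (hl.1 k).ne'))
    (tendsto_finsetProd _ fun j _ => (hk k).sub (hk j)) ?_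
  · refine Finset.prod_ne_zero_iff.2 fun j hj => sub_ne_zero.2 fun h => ?_
    exact (Finset.mem_erase.1 hj).1 (hl.2 h).symm

end QState

end

open QState

/-! Up to sign, the subentropy of a generic spectrum is the divided difference of t^n ln t at the n
eigenvalues. By the Hermite–Genocchi formula (`genocchi_eq_divDiff`) this is n! times a simplex
integral of t ln t + Σ_n t, which is continuous down to t = 0. The integral therefore gives the
continuous extension `extSubentropy` of Q to all spectra.

Let three eigenvalues x, y, z move to x', y', z' with the same sum and sum of squares. The monic
cubics p and p' with these roots differ by a constant, so 1/p' - 1/p = (x'y'z' - xyz)/(pp').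
Accordingly the divided differences differ by x'y'z' - xyz times the divided difference at all old
and new nodes together (`genocchi_three_sub`). The latter is a simplex integral of the third
derivative -1/t² of t ln t, hence negative, and Q rises strictly with the product
(`extSubentropy_lt_of_prod_lt`).

Whenever x < y ≤ z, a move that raises the product exists (`exists_triple_prod_lt`). A maximiser
exists by compactness, so all its entries except one largest coincide, and the two constraints force
the values a and b. The closed form of the maximum is Taylor's formula with integral remainder
(`integral_pow_mul_logChain`). -/

/-! ### Divided differences and Hermite–Genocchi integrals -/

/-- The divided difference of `f` at pairwise distinct nodes. -/
noncomputable def divDiff {ι : Type*} [Fintype ι] [DecidableEq ι] (f : ℝ → ℝ) (x : ι → ℝ) : ℝ :=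
  ∑ i, f (x i) / ∏ j ∈ Finset.univ.erase i, (x i - x j)

/-- The Hermite–Genocchi integral of `g` over the simplex spanned by the nodes `x`; it equals
the divided difference of order `k` of a `k`-fold antiderivative of `g`. -/
noncomputable def genocchi (g : ℝ → ℝ) : (k : ℕ) → (Fin (k + 1) → ℝ) → ℝ
  | 0, x => g (x 0)
  | k + 1, x => ∫ s in (0 : ℝ)..1, s ^ k * genocchi g k fun i => (1 - s) * x 0 + s * x i.succ

theorem continuous_genocchi {g : ℝ → ℝ} (hg : Continuous g) (k : ℕ) :
    Continuous (genocchi g k) := by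
  induction k with
  | zero => exact hg.comp (continuous_apply 0)
  | succ k ih =>
    simp only [genocchi]
    apply intervalIntegral.continuous_parametric_intervalIntegral_of_continuous'
    simp only [Function.uncurry_def]
    refine (continuous_snd.pow k).mul (ih.comp ?_)
    fun_prop

theorem continuous_genocchi_integrand {g : ℝ → ℝ} (hg : Continuous g) (k : ℕ)
    (x : Fin (k + 2) → ℝ) :
    Continuous fun s : ℝ => s ^ k * genocchi g k fun i => (1 - s) * x 0 + s * x i.succ := by
  refine (continuous_id.pow k).mul ((continuous_genocchi hg k).comp ?_)
  fun_prop

theorem genocchi_congr {g h : ℝ → ℝ} {S : Set ℝ} (hS : Convex ℝ S) (hgh : Set.EqOn g h S) (k : ℕ) :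
    ∀ x : Fin (k + 1) → ℝ, (∀ i, x i ∈ S) → genocchi g k x = genocchi h k x := by
  induction k with
  | zero => exact fun x hx => hgh (hx 0)
  | succ k ih =>
    intro x hx
    simp only [genocchi]
    refine intervalIntegral.integral_congr fun s hs => ?_
    rw [Set.uIcc_of_le zero_le_one] at hs
    exact congrArg (s ^ k * ·)
      (ih _ fun i => hS (hx 0) (hx i.succ) (by linarith [hs.2]) hs.1 (by ring))

/-- The nested weights have total mass 1/k!, the volume of the simplex. -/
theorem genocchi_le {g : ℝ → ℝ} (hg : Continuous g) {S : Set ℝ} (hS : Convex ℝ S) {c : ℝ}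
    (hgc : ∀ x ∈ S, g x ≤ c) (k : ℕ) :
    ∀ x : Fin (k + 1) → ℝ, (∀ i, x i ∈ S) → genocchi g k x ≤ c / k.factorial := by
  induction k with
  | zero => intro x hx; simpa [genocchi] using hgc _ (hx 0)
  | succ k ih =>
    intro x hx
    simp only [genocchi]
    calc _ ≤ ∫ s in (0 : ℝ)..1, s ^ k * (c / k.factorial) := by
          refine intervalIntegral.integral_mono_on zero_le_one
            ((continuous_genocchi_integrand hg k x).intervalIntegrable _ _)
            (Continuous.intervalIntegrable (by fun_prop) _ _) fun s hs => ?_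
          exact mul_le_mul_of_nonneg_left
            (ih _ fun i => hS (hx 0) (hx i.succ) (by linarith [hs.2]) hs.1 (by ring))
            (pow_nonneg hs.1 _)
      _ = c / (k + 1).factorial := by
          rw [intervalIntegral.integral_mul_const, integral_pow, Nat.factorial_succ]
          push_cast
          field_simp
          simp

theorem genocchi_const_nodes (g : ℝ → ℝ) (k : ℕ) (a : ℝ) :
    genocchi g k (fun _ => a) = g a / k.factorial := by
  induction k with
  | zero => simp [genocchi]
  | succ k ih =>
    have : ∀ s : ℝ, (1 - s) * a + s * a = a := fun s => by ring
    simp only [genocchi, this, ih]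
    rw [intervalIntegral.integral_mul_const, integral_pow, Nat.factorial_succ]
    push_cast
    field_simp
    simp

theorem prod_erase_eq_prod_ite {ι : Type*} [Fintype ι] [DecidableEq ι] (i : ι) (f : ι → ℝ) :
    ∏ j ∈ Finset.univ.erase i, f j = ∏ j, if j = i then 1 else f j := by
  rw [← Finset.mul_prod_erase Finset.univ _ (Finset.mem_univ i)]
  simp only [if_true, one_mul]
  exact Finset.prod_congr rfl fun j hj => by rw [if_neg (Finset.ne_of_mem_erase hj)]

theorem prod_erase_zero {k : ℕ} (f : Fin (k + 1) → ℝ) :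
    ∏ j ∈ Finset.univ.erase 0, f j = ∏ j : Fin k, f j.succ := by
  rw [prod_erase_eq_prod_ite, Fin.prod_univ_succ]
  simp

theorem prod_erase_succ {k : ℕ} (f : Fin (k + 1) → ℝ) (i : Fin k) :
    ∏ j ∈ Finset.univ.erase i.succ, f j = f 0 * ∏ j ∈ Finset.univ.erase i, f j.succ := by
  rw [prod_erase_eq_prod_ite, Fin.prod_univ_succ, prod_erase_eq_prod_ite]
  simp [(Fin.succ_ne_zero i).symm]

theorem prod_erase_ne_zero {ι : Type*} [Fintype ι] [DecidableEq ι] {x : ι → ℝ}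
    (hx : Function.Injective x) (i : ι) : ∏ j ∈ Finset.univ.erase i, (x i - x j) ≠ 0 :=
  Finset.prod_ne_zero_iff.2 fun _ hj =>
    sub_ne_zero.2 fun h => (Finset.ne_of_mem_erase hj) (hx h).symm

theorem divDiff_succ {k : ℕ} (f : ℝ → ℝ) (x : Fin (k + 1) → ℝ) :
    divDiff f x = f (x 0) / ∏ j : Fin k, (x 0 - x j.succ) +
      ∑ i : Fin k, f (x i.succ) /
        ((x i.succ - x 0) * ∏ j ∈ Finset.univ.erase i, (x i.succ - x j.succ)) := by
  simp only [divDiff, Fin.sum_univ_succ, prod_erase_zero, prod_erase_succ]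

theorem divDiff_comp_equiv {ι : Type*} [Fintype ι] [DecidableEq ι] (f : ℝ → ℝ) (x : ι → ℝ)
    (σ : Equiv.Perm ι) : divDiff f (x ∘ σ) = divDiff f x := by
  unfold divDiff
  refine Fintype.sum_equiv σ _ _ fun i => ?_
  simp only [prod_erase_eq_prod_ite, Function.comp]
  congr 1
  exact Fintype.prod_equiv σ _ _ fun j => by simp

/-- The sum is the coefficient of degree k + 1 in the interpolant of the constant 1. -/
theorem divDiff_one {k : ℕ} {x : Fin (k + 2) → ℝ} (hx : Function.Injective x) :
    divDiff (fun _ => 1) x = 0 := by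
  have h := Lagrange.coeff_eq_sum (s := Finset.univ) (v := x) (P := (1 : Polynomial ℝ))
    hx.injOn (by simp; exact_mod_cast Nat.succ_pos _)
  simp only [Finset.card_univ, Fintype.card_fin, Polynomial.eval_one] at h
  simpa [divDiff, Polynomial.coeff_one] using h.symm

/-- The recursion of divided differences in the first two nodes. -/
theorem divDiff_cons_sub {k : ℕ} (f : ℝ → ℝ) {x y : ℝ} {L : Fin k → ℝ}
    (h : Function.Injective (Fin.cons x (Fin.cons y L : Fin (k + 1) → ℝ) : Fin (k + 2) → ℝ)) :
    divDiff f (Fin.cons x L : Fin (k + 1) → ℝ) - divDiff f (Fin.cons y L : Fin (k + 1) → ℝ) =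
      (x - y) * divDiff f (Fin.cons x (Fin.cons y L : Fin (k + 1) → ℝ) : Fin (k + 2) → ℝ) := by
  rw [divDiff_succ, divDiff_succ f (Fin.cons y L : Fin (k + 1) → ℝ),
    divDiff_succ f (Fin.cons x (Fin.cons y L : Fin (k + 1) → ℝ) : Fin (k + 2) → ℝ)]
  simp only [Fin.cons_zero, Fin.cons_succ, Fin.prod_univ_succ, Fin.sum_univ_succ,
    prod_erase_zero, prod_erase_succ]
  rw [Fin.cons_injective_iff, Fin.cons_injective_iff] at h
  obtain ⟨hx, hy, hL⟩ := h
  have hxy : x - y ≠ 0 := sub_ne_zero.2 fun e => hx ⟨0, by simp [e]⟩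
  have hyx : y - x ≠ 0 := sub_ne_zero.2 fun e => hx ⟨0, by simp [e]⟩
  have hLx : ∀ i, L i - x ≠ 0 := fun i => sub_ne_zero.2 fun e => hx ⟨i.succ, by simp [e]⟩
  have hLy : ∀ i, L i - y ≠ 0 := fun i => sub_ne_zero.2 fun e => hy ⟨i, e⟩
  have hpx : ∏ j, (x - L j) ≠ 0 := Finset.prod_ne_zero_iff.2 fun i _ h0 =>
    hLx i (by linarith)
  have hpy : ∏ j, (y - L j) ≠ 0 := Finset.prod_ne_zero_iff.2 fun i _ h0 =>
    hLy i (by linarith)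
  have key : ∑ i, f (L i) / ((L i - x) * ∏ j ∈ Finset.univ.erase i, (L i - L j)) -
      ∑ i, f (L i) / ((L i - y) * ∏ j ∈ Finset.univ.erase i, (L i - L j)) =
      (x - y) * ∑ i, f (L i) / ((L i - x) * ((L i - y) *
        ∏ j ∈ Finset.univ.erase i, (L i - L j))) := by
    rw [← Finset.sum_sub_distrib, Finset.mul_sum]
    refine Finset.sum_congr rfl fun i _ => ?_
    have h1 := hLx i
    have h2 := hLy i
    have h3 := prod_erase_ne_zero hL i
    field_simp
    ring
  rw [mul_add, mul_add, ← key]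
  have e1 : (x - y) * (f x / ((x - y) * ∏ j, (x - L j))) = f x / ∏ j, (x - L j) := by
    field_simp
  have e2 : (x - y) * (f y / ((y - x) * ∏ j, (y - L j))) = - (f y / ∏ j, (y - L j)) := by
    have : x - y = - (y - x) := by ring
    rw [this]; field_simp
  rw [e1, e2]
  ring

/-- The Hermite–Genocchi formula. -/
theorem genocchi_eq_divDiff {F : ℕ → ℝ → ℝ} {S : Set ℝ} (hS : Convex ℝ S)
    (hF0 : Continuous (F 0)) (hF : ∀ j, ∀ x ∈ S, HasDerivAt (F (j + 1)) (F j x) x) (k : ℕ) :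
    ∀ x : Fin (k + 1) → ℝ, (∀ i, x i ∈ S) → Function.Injective x →
      genocchi (F 0) k x = divDiff (F k) x := by
  have hcont : ∀ j, ContinuousOn (F j) S := by
    rintro (_ | j)
    · exact hF0.continuousOn
    · exact fun x hx => (hF j x hx).continuousAt.continuousWithinAt
  induction k with
  | zero => intro x hx _; simp [genocchi, divDiff]
  | succ k ih =>
    intro x hx hinj
    have hmem : ∀ i : Fin (k + 1), ∀ s ∈ Set.Icc (0 : ℝ) 1, (1 - s) * x 0 + s * x i.succ ∈ S :=
      fun i s hs => hS (hx 0) (hx i.succ) (by linarith [hs.2]) hs.1 (by ring)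
    have hne : ∀ i : Fin (k + 1), x i.succ - x 0 ≠ 0 := fun i =>
      sub_ne_zero.2 fun h => Fin.succ_ne_zero i (hinj h)
    have hsub : Function.Injective fun i : Fin (k + 1) => x i.succ :=
      hinj.comp (Fin.succ_injective _)
    have hint : ∀ i : Fin (k + 1), (∫ s in (0 : ℝ)..1, F k ((1 - s) * x 0 + s * x i.succ)) =
        (F (k + 1) (x i.succ) - F (k + 1) (x 0)) / (x i.succ - x 0) := by
      intro i
      have hd : ∀ s ∈ Set.uIcc (0 : ℝ) 1,
          HasDerivAt (fun s => F (k + 1) ((1 - s) * x 0 + s * x i.succ) / (x i.succ - x 0))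
            (F k ((1 - s) * x 0 + s * x i.succ)) s := by
        intro s hs
        rw [Set.uIcc_of_le zero_le_one] at hs
        have h1 : HasDerivAt (fun s : ℝ => (1 - s) * x 0 + s * x i.succ) (x i.succ - x 0) s := by
          have := (((hasDerivAt_id s).const_sub 1).mul_const (x 0)).add
            ((hasDerivAt_id s).mul_const (x i.succ))
          exact this.congr_deriv (by ring)
        have h2 := ((hF k _ (hmem i s hs)).comp s h1).div_const (x i.succ - x 0)
        rwa [mul_div_cancel_right₀ _ (hne i)] at h2
      rw [intervalIntegral.integral_eq_sub_of_hasDerivAt hd]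
      · simp [sub_div]
      · refine ContinuousOn.intervalIntegrable ?_
        rw [Set.uIcc_of_le zero_le_one]
        exact (hcont k).comp (by fun_prop) fun s hs => hmem i s hs
    -- Contraction towards `x 0` scales the differences of the other nodes by s; the resulting s^k
    -- in the denominators cancels the weight. At s = 0 the nodes collide, but this is a null set.
    have hstep : genocchi (F 0) (k + 1) x = ∫ s in (0 : ℝ)..1, ∑ i : Fin (k + 1),
        F k ((1 - s) * x 0 + s * x i.succ) /
          ∏ j ∈ Finset.univ.erase i, (x i.succ - x j.succ) := by
      simp only [genocchi]
      refine intervalIntegral.integral_congr_ae (Eventually.of_forall fun s hs => ?_)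
      rw [Set.uIoc_of_le zero_le_one] at hs
      have hs0 : s ≠ 0 := hs.1.ne'
      rw [ih _ (fun i => hmem i s ⟨hs.1.le, hs.2⟩) (fun i j hij => hsub
        (mul_left_cancel₀ hs0 (add_left_cancel hij))), divDiff, Finset.mul_sum]
      refine Finset.sum_congr rfl fun i _ => ?_
      have : ∏ j ∈ Finset.univ.erase i, ((1 - s) * x 0 + s * x i.succ -
          ((1 - s) * x 0 + s * x j.succ)) =
          s ^ k * ∏ j ∈ Finset.univ.erase i, (x i.succ - x j.succ) := by
        rw [Finset.prod_congr rfl fun j _ => show _ = s * (x i.succ - x j.succ) by ring,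
          Finset.prod_mul_distrib, Finset.prod_const, Finset.card_erase_of_mem (Finset.mem_univ i)]
        simp
      rw [this]
      have := prod_erase_ne_zero hsub i
      field_simp
    rw [hstep, intervalIntegral.integral_finsetSum]
    · have hone := divDiff_one hinj
      rw [divDiff_succ] at hone ⊢
      -- Since the divided difference of 1 vanishes, the coefficient at `x 0` is minus the sum of
      -- the others, which supplies the lower endpoints of the integrals.
      have h0 : F (k + 1) (x 0) / ∏ j : Fin (k + 1), (x 0 - x j.succ) =
          - ∑ i : Fin (k + 1), F (k + 1) (x 0) / ((x i.succ - x 0) *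
            ∏ j ∈ Finset.univ.erase i, (x i.succ - x j.succ)) := by
        rw [div_eq_mul_one_div, eq_neg_of_add_eq_zero_left hone, mul_neg, Finset.mul_sum]
        simp only [mul_one_div]
      rw [h0, neg_add_eq_sub, ← Finset.sum_sub_distrib]
      refine Finset.sum_congr rfl fun i _ => ?_
      rw [intervalIntegral.integral_div, hint, div_div, ← sub_div]
    · intro i _
      refine ContinuousOn.intervalIntegrable ?_
      rw [Set.uIcc_of_le zero_le_one]
      exact ((hcont k).comp (by fun_prop) fun s hs => hmem i s hs).div_const _

/-! ### Divided-difference identities at repeated nodes -/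

/-- Tuples with distinct entries are dense, so continuity carries identities over to repeated nodes.
-/
theorem eq_of_eq_on_injective {n : ℕ} {A B : (Fin n → ℝ) → ℝ} (hA : Continuous A)
    (hB : Continuous B) {δ : ℝ} (hδ : 0 ≤ δ)
    (h : ∀ x, (∀ i, δ < x i) → Function.Injective x → A x = B x)
    (x : Fin n → ℝ) (hx : ∀ i, δ < x i) : A x = B x := by
  have := genericSpectra_neBot x fun i => hδ.trans (hx i).le
  have hev : A =ᶠ[𝓝[genericSpectra n] x] B := by
    have h1 : ∀ᶠ y in 𝓝[genericSpectra n] x, ∀ i, δ < y i := by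
      refine Filter.Eventually.filter_mono nhdsWithin_le_nhds ?_
      exact eventually_all.2 fun i => (continuous_apply i).continuousAt.eventually (lt_mem_nhds (hx i))
    filter_upwards [h1, self_mem_nhdsWithin] with y hy1 hy2
    exact h y hy1 hy2.2
  exact tendsto_nhds_unique ((hA.tendsto x).mono_left nhdsWithin_le_nhds)
    (((hB.tendsto x).mono_left nhdsWithin_le_nhds).congr' hev.symm)

/-- A sequence of continuous functions, each of which has the preceding one as its derivative
on the ray beyond `δ`. -/
structure IsDerivChain (F : ℕ → ℝ → ℝ) (δ : ℝ) : Prop where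
  nonneg : 0 ≤ δ
  continuous : ∀ j, Continuous (F j)
  hasDerivAt : ∀ j, ∀ x, δ < x → HasDerivAt (F (j + 1)) (F j x) x

namespace IsDerivChain

variable {F : ℕ → ℝ → ℝ} {δ : ℝ}

theorem shift (h : IsDerivChain F δ) (m : ℕ) : IsDerivChain (fun j => F (j + m)) δ where
  nonneg := h.nonneg
  continuous j := h.continuous _
  hasDerivAt j x hx := by
    have := h.hasDerivAt (j + m) x hx
    rwa [add_right_comm] at this

theorem genocchi_eq (h : IsDerivChain F δ) (m k : ℕ) (x : Fin (k + 1) → ℝ) (hx : ∀ i, δ < x i)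
    (hinj : Function.Injective x) : genocchi (F m) k x = divDiff (F (k + m)) x := by
  have := genocchi_eq_divDiff (F := fun j => F (j + m)) (convex_Ioi δ)
    (by simpa using h.continuous m) (fun j y hy => (h.shift m).hasDerivAt j y hy) k x hx hinj
  simpa using this

theorem genocchi_comp_equiv (h : IsDerivChain F δ) (m k : ℕ) (σ : Equiv.Perm (Fin (k + 1)))
    (x : Fin (k + 1) → ℝ) (hx : ∀ i, δ < x i) :
    genocchi (F m) k (x ∘ σ) = genocchi (F m) k x := by
  have hc := continuous_genocchi (h.continuous m) k
  refine eq_of_eq_on_injective (A := fun x => genocchi (F m) k (x ∘ σ))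
    (hc.comp (by fun_prop)) hc h.nonneg (fun x hx hinj => ?_) x hx
  rw [h.genocchi_eq m k x hx hinj, h.genocchi_eq m k (x ∘ σ) (fun i => hx _)
    (hinj.comp σ.injective), divDiff_comp_equiv]

theorem genocchi_cons_sub (h : IsDerivChain F δ) (m k : ℕ) (x y : ℝ) (L : Fin k → ℝ)
    (hx : δ < x) (hy : δ < y) (hL : ∀ i, δ < L i) :
    genocchi (F (m + 1)) k (Fin.cons x L : Fin (k + 1) → ℝ) -
      genocchi (F (m + 1)) k (Fin.cons y L : Fin (k + 1) → ℝ) =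
      (x - y) * genocchi (F m) (k + 1)
        (Fin.cons x (Fin.cons y L : Fin (k + 1) → ℝ) : Fin (k + 2) → ℝ) := by
  have hc := continuous_genocchi (h.continuous (m + 1)) k
  have hc' := continuous_genocchi (h.continuous m) (k + 1)
  have hcomp : ∀ z : Fin (k + 2) → ℝ, (Fin.cons (z 0) (Fin.cons (z 1) fun i : Fin k => z i.succ.succ :
      Fin (k + 1) → ℝ) : Fin (k + 2) → ℝ) = z := by
    intro z
    ext i
    refine Fin.cases rfl (fun i => ?_) i
    exact Fin.cases rfl (fun i => rfl) i
  have := eq_of_eq_on_injective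
    (A := fun z : Fin (k + 2) → ℝ =>
      genocchi (F (m + 1)) k (Fin.cons (z 0) fun i : Fin k => z i.succ.succ : Fin (k + 1) → ℝ) -
      genocchi (F (m + 1)) k (Fin.cons (z 1) fun i : Fin k => z i.succ.succ : Fin (k + 1) → ℝ))
    (B := fun z => (z 0 - z 1) * genocchi (F m) (k + 1) z)
    (by
      refine (hc.comp ?_).sub (hc.comp ?_) <;>
      · refine continuous_pi fun i => ?_
        refine Fin.cases ?_ (fun i => ?_) i <;> simp only [Fin.cons_zero, Fin.cons_succ] <;> fun_prop)
    (by fun_prop) h.nonneg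
    (fun z hz hinj => by
      rw [h.genocchi_eq m _ z hz hinj]
      have e := hcomp z
      have hinj' := hinj
      rw [← e] at hinj'
      have hinj2 := Fin.cons_injective_iff.1 hinj'
      have hinj3 := Fin.cons_injective_iff.1 hinj2.2
      have key := divDiff_cons_sub (F (k + (m + 1))) hinj'
      rw [e] at key
      rw [show F (k + 1 + m) = F (k + (m + 1)) by congr 1; omega, ← key, h.genocchi_eq (m + 1), h.genocchi_eq (m + 1)]
      · exact fun i => Fin.cases (hz 1) (fun i => hz _) i
      · exact hinj2.2
      · exact fun i => Fin.cases (hz 0) (fun i => hz _) i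
      · exact Fin.cons_injective_iff.2 ⟨fun ⟨i, hi⟩ => hinj2.1 ⟨i.succ, hi⟩, hinj3.2⟩)
    (Fin.cons x (Fin.cons y L : Fin (k + 1) → ℝ) : Fin (k + 2) → ℝ)
    (fun i => Fin.cases hx (fun i => Fin.cases hy hL i) i)
  simpa using this

end IsDerivChain

/-! ### Symmetry in the nodes and the exchange of three nodes -/

/-- Each value has equally many preimages under both maps; bijections between the fibres glue to a
permutation. -/
theorem exists_perm_of_map_univ_eq {ι : Type*} [Fintype ι] {u v : ι → ℝ}
    (h : Finset.univ.val.map u = Finset.univ.val.map v) : ∃ σ : Equiv.Perm ι, u = v ∘ σ := by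
  classical
  have hcard : ∀ c, Nonempty ({i // u i = c} ≃ {i // v i = c}) := by
    intro c
    rw [← Fintype.card_eq, Fintype.card_subtype, Fintype.card_subtype]
    have := congrArg (Multiset.count c) h
    rw [Multiset.count_map, Multiset.count_map] at this
    simpa [Finset.card_def, Finset.filter_val, eq_comm] using this
  exact ⟨Equiv.ofFiberEquiv fun c => (hcard c).some,
    funext fun i => (Equiv.ofFiberEquiv_map _ i).symm⟩

theorem map_univ_vecCons {k : ℕ} (x : ℝ) (L : Fin k → ℝ) :
    Finset.univ.val.map (Matrix.vecCons x L) = x ::ₘ Finset.univ.val.map L := by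
  simp [Fin.univ_val_map, List.ofFn_succ]

theorem forall_vecCons {k : ℕ} {p : ℝ → Prop} {x : ℝ} {L : Fin k → ℝ} (hx : p x)
    (hL : ∀ i, p (L i)) : ∀ i, p (Matrix.vecCons x L i) :=
  fun i => Fin.cases hx hL i

namespace IsDerivChain

variable {F : ℕ → ℝ → ℝ} {δ : ℝ}

theorem genocchi_eq_of_map_eq (h : IsDerivChain F δ) (m k : ℕ) {u v : Fin (k + 1) → ℝ}
    (hv : ∀ i, δ < v i) (huv : Finset.univ.val.map u = Finset.univ.val.map v) :
    genocchi (F m) k u = genocchi (F m) k v := by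
  obtain ⟨σ, rfl⟩ := exists_perm_of_map_univ_eq huv
  exact h.genocchi_comp_equiv m k σ v hv

open Matrix in
/-- If the cubics with roots `x, y, z` and `x', y', z'` differ by a constant only, the divided
differences differ by that constant times the divided difference at all nodes. -/
theorem genocchi_three_sub (h : IsDerivChain F δ) (m k : ℕ) {x y z x' y' z' : ℝ} (L : Fin k → ℝ)
    (hx : δ < x) (hy : δ < y) (hz : δ < z) (hx' : δ < x') (hy' : δ < y') (hz' : δ < z')
    (hL : ∀ i, δ < L i) (h1 : x' + y' + z' = x + y + z)
    (h2 : x' ^ 2 + y' ^ 2 + z' ^ 2 = x ^ 2 + y ^ 2 + z ^ 2) :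
    genocchi (F (m + 3)) (k + 2) (vecCons x' (vecCons y' (vecCons z' L))) -
      genocchi (F (m + 3)) (k + 2) (vecCons x (vecCons y (vecCons z L))) =
    (x' * y' * z' - x * y * z) * genocchi (F m) (k + 5)
      (vecCons x' (vecCons z (vecCons y (vecCons x (vecCons y' (vecCons z' L)))))) := by
  -- The two-node recursion, freed from the order of the nodes.
  have step : ∀ (m k : ℕ) (x y : ℝ) (L : Fin k → ℝ) (u v : Fin (k + 1) → ℝ), δ < x → δ < y →
      (∀ i, δ < L i) → Finset.univ.val.map u = x ::ₘ Finset.univ.val.map L →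
      Finset.univ.val.map v = y ::ₘ Finset.univ.val.map L →
      genocchi (F (m + 1)) k u - genocchi (F (m + 1)) k v =
        (x - y) * genocchi (F m) (k + 1) (vecCons x (vecCons y L)) := by
    intro m k x y L u v hx hy hL hu hv
    rw [h.genocchi_eq_of_map_eq (m + 1) k (forall_vecCons hx hL)
        (hu.trans (map_univ_vecCons x L).symm),
      h.genocchi_eq_of_map_eq (m + 1) k (forall_vecCons hy hL)
        (hv.trans (map_univ_vecCons y L).symm)]
    exact h.genocchi_cons_sub m k x y L hx hy hL
  -- The nodes are replaced one at a time. The three differences obtained are then compared with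
  -- each other in the same way, up to the term that contains all six nodes.
  have t1 := step (m + 2) (k + 2) x' x (vecCons y' (vecCons z' L))
    (vecCons x' (vecCons y' (vecCons z' L))) (vecCons x (vecCons y' (vecCons z' L))) hx' hx
    (forall_vecCons hy' (forall_vecCons hz' hL))
    (by simp only [map_univ_vecCons]) (by simp only [map_univ_vecCons])
  have t2 := step (m + 2) (k + 2) y' y (vecCons x (vecCons z' L))
    (vecCons x (vecCons y' (vecCons z' L))) (vecCons x (vecCons y (vecCons z' L))) hy' hy
    (forall_vecCons hx (forall_vecCons hz' hL))
    (by simp only [map_univ_vecCons, ← Multiset.singleton_add]; abel)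
    (by simp only [map_univ_vecCons, ← Multiset.singleton_add]; abel)
  have t3 := step (m + 2) (k + 2) z' z (vecCons x (vecCons y L))
    (vecCons x (vecCons y (vecCons z' L))) (vecCons x (vecCons y (vecCons z L))) hz' hz
    (forall_vecCons hx (forall_vecCons hy hL))
    (by simp only [map_univ_vecCons, ← Multiset.singleton_add]; abel)
    (by simp only [map_univ_vecCons, ← Multiset.singleton_add]; abel)
  have a12 := step (m + 1) (k + 3) x' y (vecCons x (vecCons y' (vecCons z' L)))
    (vecCons x' (vecCons x (vecCons y' (vecCons z' L))))
    (vecCons y' (vecCons y (vecCons x (vecCons z' L)))) hx' hy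
    (forall_vecCons hx (forall_vecCons hy' (forall_vecCons hz' hL)))
    (by simp only [map_univ_vecCons])
    (by simp only [map_univ_vecCons, ← Multiset.singleton_add]; abel)
  have a23 := step (m + 1) (k + 3) y' z (vecCons y (vecCons x (vecCons z' L)))
    (vecCons y' (vecCons y (vecCons x (vecCons z' L))))
    (vecCons z' (vecCons z (vecCons x (vecCons y L)))) hy' hz
    (forall_vecCons hy (forall_vecCons hx (forall_vecCons hz' hL)))
    (by simp only [map_univ_vecCons])
    (by simp only [map_univ_vecCons, ← Multiset.singleton_add]; abel)
  have b := step m (k + 4) x' z (vecCons y (vecCons x (vecCons y' (vecCons z' L))))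
    (vecCons x' (vecCons y (vecCons x (vecCons y' (vecCons z' L)))))
    (vecCons y' (vecCons z (vecCons y (vecCons x (vecCons z' L))))) hx' hz
    (forall_vecCons hy (forall_vecCons hx (forall_vecCons hy' (forall_vecCons hz' hL))))
    (by simp only [map_univ_vecCons])
    (by simp only [map_univ_vecCons, ← Multiset.singleton_add]; abel)
  set T' := genocchi (F (m + 3)) (k + 2) (vecCons x' (vecCons y' (vecCons z' L)))
  set T := genocchi (F (m + 3)) (k + 2) (vecCons x (vecCons y (vecCons z L)))
  set C := genocchi (F m) (k + 5)
    (vecCons x' (vecCons z (vecCons y (vecCons x (vecCons y' (vecCons z' L))))))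
  set A1 := genocchi (F (m + 2)) (k + 2 + 1) (vecCons x' (vecCons x (vecCons y' (vecCons z' L))))
  set A2 := genocchi (F (m + 2)) (k + 2 + 1) (vecCons y' (vecCons y (vecCons x (vecCons z' L))))
  set A3 := genocchi (F (m + 2)) (k + 2 + 1) (vecCons z' (vecCons z (vecCons x (vecCons y L))))
  have hz'' : z' = x + y + z - x' - y' := by linarith
  -- This is the coefficient of `B2` in the final expansion; that of `A3` vanishes by the equality
  -- of sums.
  have hquad : (x' - x) * (x' - y) + (z - z') * (y' - z) = 0 := by
    subst hz''
    nlinarith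
  -- The left side is p(x') = p(x') - p'(x'), and p - p' is the constant on the right.
  have hcub : (x' - x) * (x' - y) * (x' - z) = x' * y' * z' - x * y * z := by
    have e2 : x' * y' + x' * z' + y' * z' = x * y + x * z + y * z := by
      linear_combination (x' + y' + z' + x + y + z) / 2 * h1 - h2 / 2
    have : y' * z' = x * y + x * z + y * z - x' * (x + y + z - x') := by
      rw [hz''] at e2 ⊢; linarith
    rw [mul_assoc x' y', this]; ring
  have e : T' - T = (x' - x) * A1 + (y' - y) * A2 + (z' - z) * A3 := by
    rw [← t1, ← t2, ← t3]; ring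
  rw [e, ← hcub]
  set B1 := genocchi (F (m + 1)) (k + 3 + 1)
    (vecCons x' (vecCons y (vecCons x (vecCons y' (vecCons z' L)))))
  set B2 := genocchi (F (m + 1)) (k + 3 + 1)
    (vecCons y' (vecCons z (vecCons y (vecCons x (vecCons z' L)))))
  have hA1 : A1 = A2 + (x' - y) * B1 := by linear_combination a12
  have hA2 : A2 = A3 + (y' - z) * B2 := by linear_combination a23
  have hB : B1 = B2 + (x' - z) * C := by linear_combination b
  rw [hA1, hA2, hB]
  linear_combination (A3 + (y' - z) * B2) * h1 + B2 * hquad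

end IsDerivChain

/-! ### The antiderivatives of the logarithm -/

theorem harmonicTail_one : harmonicTail 1 = 0 := by simp [harmonicTail]

theorem harmonicTail_succ (m : ℕ) :
    harmonicTail (m + 2) = harmonicTail (m + 1) + 1 / (m + 2 : ℝ) := by
  rw [harmonicTail, Finset.sum_Icc_succ_top (by omega), harmonicTail]
  push_cast
  ring

/-- Successive antiderivatives of `-1 / x ^ 2`, the third one being `x log x + c x`. -/
noncomputable def logChain (c : ℝ) : ℕ → ℝ → ℝ
  | 0, x => -(x ^ 2)⁻¹
  | 1, x => x⁻¹
  | 2, x => Real.log x + 1 + c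
  | m + 3, x => x ^ (m + 1) * (Real.log x - harmonicTail (m + 1) + c) / (m + 1).factorial

theorem hasDerivAt_logChain (c : ℝ) (j : ℕ) {x : ℝ} (hx : 0 < x) :
    HasDerivAt (logChain c (j + 1)) (logChain c j x) x := by
  match j with
  | 0 => exact hasDerivAt_inv hx.ne'
  | 1 => exact ((Real.hasDerivAt_log hx.ne').add_const 1).add_const c
  | 2 =>
    have h := ((hasDerivAt_pow 1 x).mul
      (((Real.hasDerivAt_log hx.ne').sub_const (harmonicTail 1)).add_const c)).div_const
        ((1 : ℕ).factorial : ℝ)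
    refine h.congr_deriv ?_
    simp only [logChain, harmonicTail_one]
    field_simp
    simp
    ring
  | m + 3 =>
    have h := ((hasDerivAt_pow (m + 2) x).mul
      (((Real.hasDerivAt_log hx.ne').sub_const (harmonicTail (m + 2))).add_const c)).div_const
        ((m + 2).factorial : ℝ)
    refine h.congr_deriv ?_
    simp only [logChain, harmonicTail_succ, Nat.factorial_succ (m + 1)]
    have : ((m : ℝ) + 2) ≠ 0 := by positivity
    push_cast
    rw [show (m : ℝ) + 1 + 1 = m + 2 by ring]
    field_simp
    ring

/-- From index 3 on, a factor x tames the logarithm at 0. -/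
theorem continuous_logChain (c : ℝ) (m : ℕ) : Continuous (logChain c (m + 3)) := by
  have : logChain c (m + 3) = fun x => (x ^ m * (x * Real.log x) +
      x ^ (m + 1) * (c - harmonicTail (m + 1))) / (m + 1).factorial := by
    funext x
    simp only [logChain]
    ring
  rw [this]
  exact (((continuous_pow m).mul Real.continuous_mul_log).add (by fun_prop)).div_const _

theorem continuousOn_logChain (c : ℝ) (j : ℕ) : ContinuousOn (logChain c j) (Set.Ioi 0) := by
  match j with
  | 0 =>
    exact ((continuousOn_id.pow 2).inv₀ fun x hx => pow_ne_zero 2 (ne_of_gt hx)).neg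
  | j + 1 => exact fun x hx => (hasDerivAt_logChain c j hx).continuousAt.continuousWithinAt

/-- The first members of the chain are singular at 0. Freezing the argument below δ makes all of
them continuous on ℝ and keeps the derivatives beyond δ. -/
theorem isDerivChain_logChain_max (c : ℝ) {δ : ℝ} (hδ : 0 < δ) :
    IsDerivChain (fun j x => logChain c j (max x δ)) δ where
  nonneg := hδ.le
  continuous j := (continuousOn_logChain c j).comp_continuous (by fun_prop)
    fun x => lt_max_of_lt_right hδ
  hasDerivAt j x hx := by
    rw [max_eq_left hx.le]
    refine (hasDerivAt_logChain c j (hδ.trans hx)).congr_of_eventuallyEq ?_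
    filter_upwards [lt_mem_nhds hx] with y hy
    rw [max_eq_left (le_of_lt hy)]

/-! ### The continuous extension of the subentropy -/

/-- The continuous extension of the subentropy to all spectra. -/
noncomputable def extSubentropy (k : ℕ) (l : Fin (k + 1) → ℝ) : ℝ :=
  -((k + 1).factorial * genocchi (logChain (harmonicTail (k + 1)) 3) k l)

theorem continuous_extSubentropy (k : ℕ) : Continuous (extSubentropy k) :=
  (continuous_const.mul (continuous_genocchi (continuous_logChain _ 0) k)).neg

theorem genericSubentropy_eq_extSubentropy {k : ℕ} {l : Fin (k + 1) → ℝ}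
    (hl : l ∈ genericSpectra (k + 1)) : genericSubentropy l = extSubentropy k l := by
  have h := genocchi_eq_divDiff (F := fun j => logChain (harmonicTail (k + 1)) (j + 3))
    (convex_Ioi 0) (continuous_logChain _ 0)
    (fun j x hx => hasDerivAt_logChain _ (j + 3) hx) k l hl.1 hl.2
  simp only [Nat.zero_add] at h
  rw [extSubentropy, h, genericSubentropy, divDiff, Finset.mul_sum]
  congr 1
  refine Finset.sum_congr rfl fun i _ => ?_
  simp only [logChain]
  field_simp
  ring

theorem tendsto_genericSubentropy {k : ℕ} (l : Fin (k + 1) → ℝ) :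
    Tendsto genericSubentropy (𝓝[genericSpectra (k + 1)] l) (𝓝 (extSubentropy k l)) :=
  (((continuous_extSubentropy k).tendsto l).mono_left nhdsWithin_le_nhds).congr'
    (by filter_upwards [self_mem_nhdsWithin] with y hy
        exact (genericSubentropy_eq_extSubentropy hy).symm)

theorem spectralSubentropy_eq_extSubentropy {k : ℕ} {l : Fin (k + 1) → ℝ} (hl : ∀ i, 0 ≤ l i) :
    spectralSubentropy l = extSubentropy k l :=
  have := genericSpectra_neBot l hl
  (tendsto_genericSubentropy l).limUnder_eq

/-- Null eigenvalues are out of reach of `IsDerivChain`, so the symmetry is inherited in the limit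
from generic spectra. -/
theorem extSubentropy_comp_equiv {k : ℕ} (σ : Equiv.Perm (Fin (k + 1))) {l : Fin (k + 1) → ℝ}
    (hl : ∀ i, 0 ≤ l i) : extSubentropy k (l ∘ σ) = extSubentropy k l := by
  have hc := continuous_extSubentropy k
  have := genericSpectra_neBot l hl
  refine tendsto_nhds_unique (f := extSubentropy k ∘ fun l => l ∘ σ)
    (((hc.comp (by fun_prop)).tendsto l).mono_left nhdsWithin_le_nhds)
    ((tendsto_genericSubentropy l).congr' ?_)
  filter_upwards [self_mem_nhdsWithin] with y hy
  rw [Function.comp_apply, ← genericSubentropy_eq_extSubentropy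
    (show y ∘ σ ∈ genericSpectra (k + 1) from ⟨fun i => hy.1 _, hy.2.comp σ.injective⟩)]
  have h := divDiff_comp_equiv (fun t => t ^ (k + 1) * Real.log t) y σ
  simp only [divDiff] at h
  rw [genericSubentropy, genericSubentropy, h]

/-! ### Strict increase with the product of three eigenvalues -/

theorem genocchi_logChain_eq_max (c : ℝ) {δ : ℝ} (k : ℕ) {x : Fin (k + 1) → ℝ}
    (hx : ∀ i, δ < x i) :
    genocchi (logChain c 3) k x = genocchi (fun t => logChain c 3 (max t δ)) k x :=
  genocchi_congr (convex_Ioi δ) (fun t (ht : δ < t) => by rw [max_eq_left ht.le]) k x hx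

open Matrix in
/-- The subentropy increases strictly when three eigenvalues are changed in such a way that their
sum and their sum of squares are kept and their product increases. -/
theorem extSubentropy_lt_of_prod_lt {m : ℕ} {x y z x' y' z' : ℝ} {L : Fin m → ℝ}
    (hx : 0 ≤ x) (hy : 0 ≤ y) (hz : 0 ≤ z) (hx' : 0 ≤ x') (hy' : 0 ≤ y') (hz' : 0 ≤ z')
    (hL : ∀ i, 0 ≤ L i) (h1 : x' + y' + z' = x + y + z)
    (h2 : x' ^ 2 + y' ^ 2 + z' ^ 2 = x ^ 2 + y ^ 2 + z ^ 2)
    (h3 : x * y * z < x' * y' * z') :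
    extSubentropy (m + 2) (vecCons x (vecCons y (vecCons z L))) <
      extSubentropy (m + 2) (vecCons x' (vecCons y' (vecCons z' L))) := by
  set c := harmonicTail (m + 2 + 1)
  -- `B` bounds all nodes even after a shift by η < 1, so that -1/t² ≤ -1/B² there. The gain `κ`
  -- does not depend on η, and the inequality stays strict as η → 0.
  obtain ⟨B, hB0, hBx, hBy, hBz, hBx', hBy', hBz', hBL⟩ : ∃ B : ℝ, 0 < B ∧ x + 1 ≤ B ∧ y + 1 ≤ B ∧
      z + 1 ≤ B ∧ x' + 1 ≤ B ∧ y' + 1 ≤ B ∧ z' + 1 ≤ B ∧ ∀ i, L i + 1 ≤ B := by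
    refine ⟨x + y + z + x' + y' + z' + ∑ i, L i + 1, ?_, ?_, ?_, ?_, ?_, ?_, ?_, fun i => ?_⟩
    any_goals linarith [Finset.sum_nonneg fun i (_ : i ∈ Finset.univ) => hL i]
    linarith [Finset.single_le_sum (fun i _ => hL i) (Finset.mem_univ i)]
  set κ : ℝ := (m + 2 + 1).factorial * ((x' * y' * z' - x * y * z) *
    ((B ^ 2)⁻¹ / (m + 5).factorial))
  have hκ : 0 < κ := by
    have := sub_pos.2 h3
    positivity
  let A : ℝ → Fin (m + 3) → ℝ := fun η =>
    vecCons (x + η) (vecCons (y + η) (vecCons (z + η) fun i => L i + η))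
  let A' : ℝ → Fin (m + 3) → ℝ := fun η =>
    vecCons (x' + η) (vecCons (y' + η) (vecCons (z' + η) fun i => L i + η))
  have hA : Continuous A := Continuous.matrixVecCons (by fun_prop)
    (Continuous.matrixVecCons (by fun_prop) (Continuous.matrixVecCons (by fun_prop) (by fun_prop)))
  have hA' : Continuous A' := Continuous.matrixVecCons (by fun_prop)
    (Continuous.matrixVecCons (by fun_prop) (Continuous.matrixVecCons (by fun_prop) (by fun_prop)))
  have hlow : ∀ η ∈ Set.Ioo (0 : ℝ) 1,
      κ ≤ extSubentropy (m + 2) (A' η) - extSubentropy (m + 2) (A η) := by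
    rintro η ⟨hη, hη1⟩
    have hδ : (0 : ℝ) < η / 2 := by positivity
    have hch := isDerivChain_logChain_max c hδ
    have hpos : ∀ t : ℝ, 0 ≤ t → η / 2 < t + η := fun t ht => by linarith
    have hpA : ∀ i, η / 2 < A η i := forall_vecCons (hpos x hx)
      (forall_vecCons (hpos y hy) (forall_vecCons (hpos z hz) fun i => hpos _ (hL i)))
    have hpA' : ∀ i, η / 2 < A' η i := forall_vecCons (hpos x' hx')
      (forall_vecCons (hpos y' hy') (forall_vecCons (hpos z' hz') fun i => hpos _ (hL i)))
    have key := hch.genocchi_three_sub 0 m (fun i => L i + η) (hpos x hx) (hpos y hy) (hpos z hz)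
      (hpos x' hx') (hpos y' hy') (hpos z' hz') (fun i => hpos _ (hL i)) (by linarith)
      (by linear_combination h2 + 2 * η * h1)
    -- A common shift changes the product by terms in the first two elementary symmetric functions,
    -- which agree for both triples.
    have hprod : (x' + η) * (y' + η) * (z' + η) - (x + η) * (y + η) * (z + η) =
        x' * y' * z' - x * y * z := by
      linear_combination η ^ 2 * h1 + η * ((x' + y' + z' + x + y + z) / 2 * h1 - h2 / 2)
    rw [hprod] at key
    have hle := genocchi_le (hch.continuous 0) (convex_Iic B) (c := -(B ^ 2)⁻¹)
      (fun t ht => by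
        simp only [logChain]
        have h0 : 0 < max t (η / 2) := lt_max_of_lt_right hδ
        have : max t (η / 2) ≤ B := max_le ht (by linarith)
        gcongr) (m + 5) _
      (forall_vecCons (p := (· ∈ Set.Iic B)) (show x' + η ≤ B by linarith)
        (forall_vecCons (p := (· ∈ Set.Iic B)) (show z + η ≤ B by linarith)
        (forall_vecCons (p := (· ∈ Set.Iic B)) (show y + η ≤ B by linarith)
        (forall_vecCons (p := (· ∈ Set.Iic B)) (show x + η ≤ B by linarith)
        (forall_vecCons (p := (· ∈ Set.Iic B)) (show y' + η ≤ B by linarith)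
        (forall_vecCons (p := (· ∈ Set.Iic B)) (show z' + η ≤ B by linarith)
        (fun i => show L i + η ≤ B by linarith [hBL i])))))))
    rw [extSubentropy, extSubentropy, genocchi_logChain_eq_max _ _ hpA,
      genocchi_logChain_eq_max _ _ hpA']
    have hd := mul_le_mul_of_nonneg_left hle (sub_pos.2 h3).le
    rw [← key] at hd
    have hd' := mul_le_mul_of_nonneg_left hd
      (Nat.cast_nonneg (α := ℝ) (m + 2 + 1).factorial)
    simp only [κ]
    rw [neg_div, mul_neg, mul_neg] at hd'
    linarith
  have hlim : Tendsto (fun η => extSubentropy (m + 2) (A' η) - extSubentropy (m + 2) (A η))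
      (𝓝[>] 0) (𝓝 (extSubentropy (m + 2) (A' 0) - extSubentropy (m + 2) (A 0))) :=
    ((((continuous_extSubentropy _).comp hA').sub
      ((continuous_extSubentropy _).comp hA)).tendsto 0).mono_left nhdsWithin_le_nhds
  have := ge_of_tendsto hlim (by
    filter_upwards [Ioo_mem_nhdsGT (zero_lt_one (α := ℝ))] with η hη using hlow η hη)
  simp only [A, A', add_zero] at this
  linarith

/-- With x' = (x+y)/2, the other two are the roots of the quadratic fixed by the remaining sum `S`,
with discriminant `D` = (z' - y')². The gain in the product is (x'-x)(x'-y)(x'-z), which is positive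
because x < x' < y ≤ z. -/
theorem exists_triple_prod_lt {x y z : ℝ} (hx : 0 ≤ x) (hxy : x < y) (hyz : y ≤ z) :
    ∃ x' y' z' : ℝ, 0 ≤ x' ∧ 0 ≤ y' ∧ 0 ≤ z' ∧ x' + y' + z' = x + y + z ∧
      x' ^ 2 + y' ^ 2 + z' ^ 2 = x ^ 2 + y ^ 2 + z ^ 2 ∧ x * y * z < x' * y' * z' := by
  set S := (x + y) / 2 + z
  set D := 2 * (x ^ 2 + y ^ 2 + z ^ 2 - ((x + y) / 2) ^ 2) - S ^ 2 with hD
  have hD0 : 0 ≤ D := by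
    have : D = (y - z) ^ 2 + (y - x) / 2 * (2 * (z - x) + (y - x) / 2) := by
      simp only [hD, S]; ring
    rw [this]
    have h1 : 0 ≤ y - x := by linarith
    have h2 : 0 ≤ z - x := by linarith
    positivity
  have hr := Real.sq_sqrt hD0
  set r := Real.sqrt D
  have hr0 : 0 ≤ r := Real.sqrt_nonneg D
  have hS : 0 < S := by simp only [S]; linarith
  have hx' : 0 < (x + y) / 2 := by linarith
  have hz' : 0 < (S + r) / 2 := by linarith
  have hprod : (x + y) / 2 * ((S - r) / 2) * ((S + r) / 2) =
      x * y * z + (y - x) / 2 * ((y - x) / 2 * (z - (x + y) / 2)) := by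
    have : (x + y) / 2 * ((S - r) / 2) * ((S + r) / 2) = (x + y) / 2 * ((S ^ 2 - r ^ 2) / 4) := by
      ring
    rw [this, hr, hD]
    simp only [S]
    ring
  have hlt : x * y * z < (x + y) / 2 * ((S - r) / 2) * ((S + r) / 2) := by
    rw [hprod]
    have h1 : 0 < y - x := by linarith
    have h2 : 0 < z - (x + y) / 2 := by linarith
    have : 0 < (y - x) / 2 * ((y - x) / 2 * (z - (x + y) / 2)) := by positivity
    linarith
  -- The product exceeds xyz ≥ 0 and the other two factors are positive.
  have hy' : 0 < (S - r) / 2 := by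
    have h0 : 0 < (x + y) / 2 * ((S - r) / 2) * ((S + r) / 2) :=
      lt_of_le_of_lt (mul_nonneg (mul_nonneg hx (by linarith)) (by linarith)) hlt
    exact pos_of_mul_pos_right (pos_of_mul_pos_left h0 hz'.le) hx'.le
  refine ⟨(x + y) / 2, (S - r) / 2, (S + r) / 2, hx'.le, hy'.le, hz'.le, ?_, ?_, hlt⟩
  · simp only [S]; ring
  · have : ((S - r) / 2) ^ 2 + ((S + r) / 2) ^ 2 = (S ^ 2 + r ^ 2) / 2 := by ring
    rw [add_assoc, this, hr, hD]
    ring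

/-! ### Maximisation over the spectra of fixed purity -/

/-- The spectra of the states on `ℂ ^ n` of purity `P`. -/
def puritySpectra (n : ℕ) (P : ℝ) : Set (Fin n → ℝ) :=
  {l | (∀ i, 0 ≤ l i) ∧ ∑ i, l i = 1 ∧ ∑ i, l i ^ 2 = P}

theorem isCompact_puritySpectra (n : ℕ) (P : ℝ) : IsCompact (puritySpectra n P) := by
  refine IsCompact.of_isClosed_subset (isCompact_univ_pi fun _ : Fin n => isCompact_Icc (a := (0 : ℝ))
    (b := 1)) ?_ fun l hl i hi => ⟨hl.1 i, ?_⟩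
  · refine IsClosed.and ?_ (IsClosed.and ?_ ?_)
    · simp only [Set.ofPred_forall]
      exact isClosed_iInter fun i => isClosed_le continuous_const (continuous_apply i)
    · exact isClosed_eq (by fun_prop) continuous_const
    · exact isClosed_eq (by fun_prop) continuous_const
  · rw [← hl.2.1]
    exact Finset.single_le_sum (fun j _ => hl.1 j) (Finset.mem_univ i)

theorem comp_equiv_mem_puritySpectra {n : ℕ} {P : ℝ} {l : Fin n → ℝ} (hl : l ∈ puritySpectra n P)
    (σ : Equiv.Perm (Fin n)) : l ∘ σ ∈ puritySpectra n P :=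
  ⟨fun _ => hl.1 _, (Equiv.sum_comp σ l).trans hl.2.1,
    (Equiv.sum_comp σ fun i => l i ^ 2).trans hl.2.2⟩

theorem exists_extSubentropy_lt {k : ℕ} {P : ℝ} {l : Fin (k + 1) → ℝ}
    (hl : l ∈ puritySpectra (k + 1) P) {p q r : Fin (k + 1)} (hpr : p ≠ r) (hqr : q ≠ r)
    (hlt : l p < l q) (hle : l q ≤ l r) :
    ∃ l' ∈ puritySpectra (k + 1) P, extSubentropy k l < extSubentropy k l' := by
  have hpq : p ≠ q := fun h => by simp [h] at hlt
  obtain ⟨m, rfl⟩ : ∃ m, k = m + 2 := by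
    refine ⟨k - 2, ?_⟩
    have := p.2; have := q.2; have := r.2
    have := Fin.val_ne_of_ne hpr; have := Fin.val_ne_of_ne hqr; have := Fin.val_ne_of_ne hpq
    omega
  obtain ⟨σ, hσ⟩ := Equiv.Perm.exists_extending_pair (β := Fin (m + 2 + 1))
    ![0, 1, 2] ![p, q, r] (by
      intro i j hij
      fin_cases i <;> fin_cases j <;> simp [Fin.ext_iff, Nat.mod_eq_of_lt] at hij ⊢) (by
      intro i j hij
      fin_cases i <;> fin_cases j <;> simp_all [eq_comm])
  have hσ0 : σ 0 = p := hσ 0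
  have hσ1 : σ 1 = q := hσ 1
  have hσ2 : σ 2 = r := hσ 2
  set L : Fin m → ℝ := fun i => l (σ i.succ.succ.succ)
  have hw : l ∘ σ = Matrix.vecCons (l p) (Matrix.vecCons (l q) (Matrix.vecCons (l r) L)) := by
    ext i
    refine Fin.cases (by simp [hσ0]) (fun i => ?_) i
    refine Fin.cases (by simp [hσ1]) (fun i => ?_) i
    refine Fin.cases ?_ (fun i => by simp [L]) i
    simp [← hσ2]
  have hw' := comp_equiv_mem_puritySpectra hl σ
  obtain ⟨x', y', z', hx', hy', hz', h1, h2, h3⟩ := exists_triple_prod_lt (hl.1 p) hlt hle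
  refine ⟨Matrix.vecCons x' (Matrix.vecCons y' (Matrix.vecCons z' L)),
    ⟨forall_vecCons hx' (forall_vecCons hy' (forall_vecCons hz' fun i => hl.1 _)), ?_, ?_⟩, ?_⟩
  · have := hw'.2.1
    rw [hw] at this
    simp only [Fin.sum_univ_succ, Matrix.cons_val_zero, Matrix.cons_val_succ] at this ⊢
    linarith
  · have := hw'.2.2
    rw [hw] at this
    simp only [Fin.sum_univ_succ, Matrix.cons_val_zero, Matrix.cons_val_succ] at this ⊢
    linarith
  · rw [← extSubentropy_comp_equiv σ hl.1, hw]
    exact extSubentropy_lt_of_prod_lt (hl.1 _) (hl.1 _) (hl.1 _) hx' hy' hz' (fun i => hl.1 _)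
      h1 h2 h3

/-- The spectrum with one entry `b` and all other entries `a`. -/
noncomputable def extremalSpectrum (k : ℕ) (P : ℝ) : Fin (k + 1) → ℝ :=
  Matrix.vecCons (eigB (k + 1) P) fun _ => eigA (k + 1) P

/-- Eliminating b shows that (nP-1)/(n-1) = (b-a)², and a ≤ b selects the root b - a. -/
theorem eig_of_sum {k : ℕ} (hk : 1 ≤ k) {a b P : ℝ} (hab : a ≤ b) (h1 : b + k * a = 1)
    (h2 : b ^ 2 + k * a ^ 2 = P) : eigA (k + 1) P = a ∧ eigB (k + 1) P = b := by
  have hk0 : (k : ℝ) ≠ 0 := by positivity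
  have hk1 : (k : ℝ) + 1 ≠ 0 := by positivity
  have hb : b = 1 - k * a := by linarith
  have heps : epsOf (k + 1) P = b - a := by
    rw [epsOf, show ((((k + 1 : ℕ) : ℝ) * P - 1) / (((k + 1 : ℕ) : ℝ) - 1)) = (b - a) ^ 2 by
      push_cast
      rw [add_sub_cancel_right, div_eq_iff hk0, ← h2, hb]
      ring]
    exact Real.sqrt_sq (by linarith)
  have hA : eigA (k + 1) P = a := by
    rw [eigA, heps, hb]
    push_cast
    field_simp
    ring
  refine ⟨hA, ?_⟩
  have : eigB (k + 1) P = epsOf (k + 1) P + eigA (k + 1) P := rfl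
  rw [this, hA, heps]
  ring

theorem extSubentropy_le_extremal {k : ℕ} (hk : 1 ≤ k) {P : ℝ} {l : Fin (k + 1) → ℝ}
    (hl : l ∈ puritySpectra (k + 1) P) :
    extSubentropy k l ≤ extSubentropy k (extremalSpectrum k P) := by
  obtain ⟨w, hw, hmax⟩ := (isCompact_puritySpectra (k + 1) P).exists_isMaxOn ⟨l, hl⟩
    (continuous_extSubentropy k).continuousOn
  refine (hmax hl).trans (le_of_eq ?_)
  obtain ⟨r, hr⟩ := Finite.exists_max w
  -- Two different entries away from the largest one would form, together with it, a triple that can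
  -- be improved.
  have heq : ∀ p q, p ≠ r → q ≠ r → w q ≤ w p := by
    intro p q hp hq
    by_contra! hlt
    obtain ⟨l', hl', hlt'⟩ := exists_extSubentropy_lt hw hp hq hlt (hr q)
    exact absurd (hmax hl') (not_le.2 hlt')
  have : Nontrivial (Fin (k + 1)) := Fin.nontrivial_iff_two_le.2 (by omega)
  obtain ⟨q, hq⟩ := exists_ne r
  have hform : w ∘ Equiv.swap 0 r = Matrix.vecCons (w r) fun _ => w q := by
    ext i
    refine Fin.cases (by simp) (fun i => ?_) i
    have : Equiv.swap 0 r i.succ ≠ r := by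
      rw [Ne, Equiv.swap_apply_eq_iff, Equiv.swap_apply_right]
      exact Fin.succ_ne_zero i
    simpa using le_antisymm (heq _ _ hq this) (heq _ _ this hq)
  have hmem := comp_equiv_mem_puritySpectra hw (Equiv.swap 0 r)
  rw [hform] at hmem
  have h1 := hmem.2.1
  have h2 := hmem.2.2
  simp [Fin.sum_univ_succ] at h1 h2
  obtain ⟨ha, hb⟩ := eig_of_sum hk (hr q) h1 h2
  rw [extremalSpectrum, ha, hb, ← hform, extSubentropy_comp_equiv _ hw.1]

/-! ### The value of the maximum -/

/-- Taylor's formula with integral remainder along a chain of antiderivatives. -/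
theorem integral_pow_mul_logChain (c : ℝ) {a b : ℝ} (ha : 0 ≤ a) (hab : a < b) (m : ℕ) :
    ∀ j, (b - a) ^ (m + 1) *
      ((∫ s in (0 : ℝ)..1, s ^ m * logChain c (j + 3) ((1 - s) * b + s * a)) / m.factorial) =
      logChain c (j + m + 4) b - ∑ i ∈ Finset.range (m + 1),
        logChain c (j + i + 4) a * (b - a) ^ (m - i) / (m - i).factorial := by
  have hpos : ∀ s ∈ Set.Ioo (0 : ℝ) 1, 0 < (1 - s) * b + s * a := fun s hs => by
    have h1 := mul_pos (sub_pos.2 hs.2) (lt_of_le_of_lt ha hab)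
    have h2 := mul_nonneg hs.1.le ha
    linarith
  have hcont : ∀ j, Continuous fun s : ℝ => logChain c (j + 3) ((1 - s) * b + s * a) := fun j =>
    (continuous_logChain c j).comp (by fun_prop)
  -- At s = 1 the argument is a, which may be 0, so the endpoints are excluded.
  have hder : ∀ j, ∀ s ∈ Set.Ioo (0 : ℝ) 1,
      HasDerivAt (fun s : ℝ => logChain c (j + 4) ((1 - s) * b + s * a))
        (logChain c (j + 3) ((1 - s) * b + s * a) * (a - b)) s := fun j s hs => by
    have h1 : HasDerivAt (fun s : ℝ => (1 - s) * b + s * a) (a - b) s :=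
      ((((hasDerivAt_id s).const_sub 1).mul_const b).add
        ((hasDerivAt_id s).mul_const a)).congr_deriv (by ring)
    exact (hasDerivAt_logChain c (j + 3) (hpos s hs)).comp s h1
  have hcont' : ∀ m j, Continuous fun s : ℝ => s ^ m * logChain c (j + 3) ((1 - s) * b + s * a) :=
    fun m j => (continuous_pow m).mul (hcont j)
  -- Integration by parts lowers the power of s and raises the index of the chain, hence the
  -- statement for all j.
  induction m with
  | zero =>
    intro j
    have h := intervalIntegral.integral_eq_sub_of_hasDerivAt_of_le zero_le_one
      (hcont (j + 1)).continuousOn (hder j) (((hcont j).mul continuous_const).intervalIntegrable _ _)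
    rw [intervalIntegral.integral_mul_const] at h
    simp at h ⊢
    linarith
  | succ m ih =>
    intro j
    have hd : ∀ s ∈ Set.Ioo (0 : ℝ) 1, HasDerivAt
        (fun s : ℝ => s ^ (m + 1) * logChain c (j + 4) ((1 - s) * b + s * a))
        ((m + 1) * (s ^ m * logChain c (j + 4) ((1 - s) * b + s * a)) +
          (s ^ (m + 1) * logChain c (j + 3) ((1 - s) * b + s * a)) * (a - b)) s := fun s hs => by
      refine ((hasDerivAt_pow (m + 1) s).mul (hder j s hs)).congr_deriv ?_
      push_cast
      ring
    have i1 : IntervalIntegrable (fun s : ℝ => ((m : ℝ) + 1) *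
        (s ^ m * logChain c (j + 4) ((1 - s) * b + s * a))) MeasureTheory.volume 0 1 :=
      (continuous_const.mul (hcont' m (j + 1))).intervalIntegrable _ _
    have i2 : IntervalIntegrable (fun s : ℝ =>
        s ^ (m + 1) * logChain c (j + 3) ((1 - s) * b + s * a) * (a - b))
        MeasureTheory.volume 0 1 :=
      ((hcont' (m + 1) j).mul continuous_const).intervalIntegrable _ _
    have h := intervalIntegral.integral_eq_sub_of_hasDerivAt_of_le zero_le_one
      (hcont' (m + 1) (j + 1)).continuousOn hd
      (i1.add i2)
    rw [intervalIntegral.integral_add i1 i2,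
      intervalIntegral.integral_const_mul, intervalIntegral.integral_mul_const] at h
    have ih' := ih (j + 1)
    rw [Finset.sum_range_succ']
    simp only [Nat.add_sub_add_right]
    simp only [show ∀ i, j + 1 + i = j + (i + 1) from fun i => by ring,
      show j + 1 + 3 = j + 4 from rfl] at ih'
    rw [← sub_sub, ← ih']
    simp at h
    have hm : ((m : ℝ) + 1) ≠ 0 := by positivity
    simp only [Nat.factorial_succ, add_zero, Nat.sub_zero]
    generalize (∫ s in (0 : ℝ)..1, s ^ m * logChain c (j + 4) ((1 - s) * b + s * a)) = I at *
    generalize (∫ s in (0 : ℝ)..1, s ^ (m + 1) * logChain c (j + 3) ((1 - s) * b + s * a)) = J at *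
    push_cast
    field_simp
    linear_combination (-(b - a) ^ (m + 1)) * h

theorem sum_Icc_two (m : ℕ) (f : ℕ → ℝ) :
    ∑ k ∈ Finset.Icc 2 (m + 2), f k = ∑ i ∈ Finset.range (m + 1), f (i + 2) := by
  rw [show Finset.Icc 2 (m + 2) = Finset.Ico 2 (m + 3) by ext; simp; omega,
    Finset.sum_Ico_eq_sum_range]
  exact Finset.sum_congr rfl fun i _ => by rw [add_comm]

/-- The binomial expansion of (a + (b-a))^(m+2) without its first two terms; it collects the
contributions of the constant c of `logChain`. -/
theorem sum_choose_mul_pow_div {m : ℕ} {a b : ℝ} (hab : a < b) :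
    ∑ i ∈ Finset.range (m + 1), ((m + 2).choose (i + 2) : ℝ) * (a ^ (i + 2) / (b - a) ^ (i + 1)) =
      b ^ (m + 2) / (b - a) ^ (m + 1) - (b - a) - (m + 2) * a := by
  have hd : b - a ≠ 0 := (sub_pos.2 hab).ne'
  have h := add_pow a (b - a) (m + 2)
  rw [add_sub_cancel, Finset.sum_range_succ', Finset.sum_range_succ'] at h
  have e : ∑ i ∈ Finset.range (m + 1), a ^ (i + 1 + 1) * (b - a) ^ (m + 2 - (i + 1 + 1)) *
      ((m + 2).choose (i + 1 + 1) : ℝ) = (∑ i ∈ Finset.range (m + 1),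
        ((m + 2).choose (i + 2) : ℝ) * (a ^ (i + 2) / (b - a) ^ (i + 1))) * (b - a) ^ (m + 1) := by
    rw [Finset.sum_mul]
    refine Finset.sum_congr rfl fun i hi => ?_
    have hi' : i ≤ m := Nat.lt_succ_iff.1 (Finset.mem_range.1 hi)
    have : (b - a) ^ (m + 1) = (b - a) ^ (m + 2 - (i + 1 + 1)) * (b - a) ^ (i + 1) := by
      rw [← pow_add]; congr 1; omega
    rw [this]
    field_simp
  rw [e] at h
  simp at h
  rw [h]
  field_simp
  ring

/-- The subentropy of a spectrum with one entry `b` and all other entries `a < b`. -/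
theorem extSubentropy_vecCons_const {m : ℕ} {a b : ℝ} (ha : 0 ≤ a) (hab : a < b)
    (h1 : b + (m + 1) * a = 1) :
    extSubentropy (m + 1) (Matrix.vecCons b fun _ => a) =
      (∑ k ∈ Finset.Icc 2 (m + 2), ((m + 2).choose k : ℝ) *
        (a ^ k * (Real.log a - harmonicTail k) / (b - a) ^ (k - 1)))
      - b ^ (m + 2) * (Real.log b - harmonicTail (m + 2)) / (b - a) ^ (m + 1)
      - harmonicTail (m + 2) := by
  have hd : b - a ≠ 0 := (sub_pos.2 hab).ne'
  set c := harmonicTail (m + 2) with hc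
  -- After one contraction all nodes coincide, so the inner integral is a value divided by m!.
  have hI : genocchi (logChain c 3) (m + 1) (Matrix.vecCons b fun _ => a) =
      (∫ s in (0 : ℝ)..1, s ^ m * logChain c 3 ((1 - s) * b + s * a)) / m.factorial := by
    simp only [genocchi, Matrix.cons_val_zero, Matrix.cons_val_succ, genocchi_const_nodes]
    rw [← intervalIntegral.integral_div]
    simp only [mul_div_assoc]
  have hT := integral_pow_mul_logChain c ha hab m 0
  rw [extSubentropy, hI]
  simp only [Nat.zero_add] at hT
  rw [eq_div_of_mul_eq (pow_ne_zero _ hd) ((mul_comm _ _).trans hT), sum_Icc_two]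
  have hterm : ∀ i ∈ Finset.range (m + 1), ((m + 1 + 1).factorial : ℝ) *
      (logChain c (i + 4) a * (b - a) ^ (m - i) / (m - i).factorial / (b - a) ^ (m + 1)) =
      ((m + 2).choose (i + 2) : ℝ) *
        (a ^ (i + 2) * (Real.log a - harmonicTail (i + 2)) / (b - a) ^ (i + 2 - 1)) +
      c * (((m + 2).choose (i + 2) : ℝ) * (a ^ (i + 2) / (b - a) ^ (i + 1))) := by
    intro i hi
    have hi' : i ≤ m := Nat.lt_succ_iff.1 (Finset.mem_range.1 hi)
    have hp : (b - a) ^ (m + 1) = (b - a) ^ (m - i) * (b - a) ^ (i + 1) := by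
      rw [← pow_add]; congr 1; omega
    have hch : ((m + 2).choose (i + 2) : ℝ) * ((i + 2).factorial * (m - i).factorial) =
        (m + 2).factorial := by
      have := Nat.choose_mul_factorial_mul_factorial (n := m + 2) (k := i + 2) (by omega)
      rw [show m + 2 - (i + 2) = m - i by omega] at this
      rw [← mul_assoc]
      exact_mod_cast this
    rw [show m + 1 + 1 = m + 2 from rfl, ← hch, hp]
    simp only [logChain, show i + 2 - 1 = i + 1 from rfl]
    have h1 : ((i + 2).factorial : ℝ) ≠ 0 := by positivity
    have h2 : ((m - i).factorial : ℝ) ≠ 0 := by positivity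
    rw [show i + 1 + 1 = i + 2 from rfl]
    field_simp
  rw [sub_div, mul_sub, Finset.sum_div, Finset.mul_sum, Finset.sum_congr rfl hterm,
    Finset.sum_add_distrib, ← Finset.mul_sum, sum_choose_mul_pow_div hab]
  have hb : ((m + 1 + 1).factorial : ℝ) * (logChain c (m + 4) b / (b - a) ^ (m + 1)) =
      b ^ (m + 2) * Real.log b / (b - a) ^ (m + 1) := by
    simp only [logChain, show m + 1 + 1 = m + 2 from rfl, ← hc]
    have : ((m + 2).factorial : ℝ) ≠ 0 := by positivity
    field_simp
    ring
  rw [hb]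
  -- What remains of the c-terms is -c((b-a) + (m+2)a), and the bracket is the trace 1.
  linear_combination (-c) * h1

/-! ### The extremal spectrum as a function of the purity -/

theorem epsOf_le_one {n : ℕ} (hn : 2 ≤ n) {P : ℝ} (hP : P ≤ 1) : epsOf n P ≤ 1 := by
  have hn' : (2 : ℝ) ≤ n := by exact_mod_cast hn
  rw [epsOf, Real.sqrt_le_one, div_le_one (by linarith)]
  nlinarith

theorem epsOf_pos {n : ℕ} (hn : 2 ≤ n) {P : ℝ} (hP : 1 / (n : ℝ) < P) : 0 < epsOf n P := by
  have hn' : (2 : ℝ) ≤ n := by exact_mod_cast hn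
  rw [div_lt_iff₀ (by linarith)] at hP
  exact Real.sqrt_pos.2 (div_pos (by linarith) (by linarith))

theorem eigA_nonneg {n : ℕ} (hn : 2 ≤ n) {P : ℝ} (hP : P ≤ 1) : 0 ≤ eigA n P :=
  div_nonneg (sub_nonneg.2 (epsOf_le_one hn hP)) (Nat.cast_nonneg n)

theorem eigB_eq (n : ℕ) (P : ℝ) : eigB n P = epsOf n P + eigA n P := rfl

theorem eigB_add_mul_eigA (k : ℕ) (P : ℝ) : eigB (k + 1) P + k * eigA (k + 1) P = 1 := by
  rw [eigB, eigA]
  push_cast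
  field_simp
  ring

theorem extremalSpectrum_mem {k : ℕ} (hk : 1 ≤ k) {P : ℝ} (hP : 1 / ((k + 1 : ℕ) : ℝ) ≤ P)
    (hP1 : P ≤ 1) : extremalSpectrum k P ∈ puritySpectra (k + 1) P := by
  have hA := eigA_nonneg (n := k + 1) (by omega) hP1
  have hk0 : (0 : ℝ) < k := by exact_mod_cast hk
  have hsq : epsOf (k + 1) P ^ 2 = ((k + 1) * P - 1) / k := by
    rw [epsOf, Real.sq_sqrt]
    · push_cast; rw [add_sub_cancel_right]
    · rw [div_le_iff₀ (by positivity)] at hP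
      push_cast at hP ⊢
      exact div_nonneg (by linarith) (by linarith)
  refine ⟨forall_vecCons ?_ fun _ => hA, ?_, ?_⟩
  · exact add_nonneg (Real.sqrt_nonneg _) hA
  · simpa [extremalSpectrum, Fin.sum_univ_succ] using eigB_add_mul_eigA k P
  · simp only [extremalSpectrum, Fin.sum_univ_succ, Matrix.cons_val_zero, Matrix.cons_val_succ,
      Finset.sum_const, Finset.card_univ, Fintype.card_fin, nsmul_eq_mul, eigB, eigA]
    rw [eq_div_iff hk0.ne'] at hsq
    push_cast
    field_simp
    linear_combination (k + 1 : ℝ) * hsq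

theorem continuous_extremalSpectrum (k : ℕ) : Continuous (extremalSpectrum k) := by
  have : Continuous (epsOf (k + 1)) := by unfold epsOf; fun_prop
  have hA : Continuous (eigA (k + 1)) := by unfold eigA; fun_prop
  have hB : Continuous (eigB (k + 1)) := by unfold eigB; fun_prop
  exact hB.matrixVecCons (by fun_prop)

theorem extSubentropy_extremal_eq_formula {k : ℕ} (hk : 1 ≤ k) {P : ℝ}
    (hP : 1 / ((k + 1 : ℕ) : ℝ) < P) (hP1 : P ≤ 1) :
    extSubentropy k (extremalSpectrum k P) = maxSubentropyFormula (k + 1) P := by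
  obtain ⟨m, rfl⟩ : ∃ m, k = m + 1 := ⟨k - 1, by omega⟩
  have h := eigB_add_mul_eigA (m + 1) P
  push_cast at h
  exact extSubentropy_vecCons_const (eigA_nonneg (by omega) hP1)
    (by rw [eigB_eq]; linarith [epsOf_pos (by omega) hP]) h

theorem extSubentropy_extremal_of_eq {k : ℕ} :
    extSubentropy k (extremalSpectrum k (1 / ((k + 1 : ℕ) : ℝ))) =
      Real.log ((k + 1 : ℕ) : ℝ) - harmonicTail (k + 1) := by
  have hn : ((k + 1 : ℕ) : ℝ) ≠ 0 := by positivity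
  have he : epsOf (k + 1) (1 / ((k + 1 : ℕ) : ℝ)) = 0 := by
    rw [epsOf, mul_one_div_cancel hn, sub_self, zero_div, Real.sqrt_zero]
  have hspec : extremalSpectrum k (1 / ((k + 1 : ℕ) : ℝ)) = fun _ => 1 / ((k + 1 : ℕ) : ℝ) := by
    ext i
    refine Fin.cases ?_ (fun i => ?_) i <;>
      simp only [extremalSpectrum, eigA, eigB, he, Matrix.cons_val_zero, Matrix.cons_val_succ] <;>
      ring
  rw [hspec, extSubentropy, genocchi_const_nodes]
  simp only [logChain, Nat.zero_add, harmonicTail_one, one_div, Real.log_inv, Nat.factorial_succ]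
  have : (k.factorial : ℝ) ≠ 0 := by positivity
  push_cast at hn ⊢
  field_simp
  simp
  ring

/-! ### From spectra to density matrices -/

open Matrix Unitary in
theorem trace_conjStarAlgAut {n : ℕ} (U : unitary (Matrix (Fin n) (Fin n) ℂ))
    (X : Matrix (Fin n) (Fin n) ℂ) : (conjStarAlgAut ℂ _ U X).trace = X.trace := by
  rw [conjStarAlgAut_apply, trace_mul_cycle, Unitary.coe_star_mul_self, one_mul]

open Matrix Unitary in
theorem charpoly_conjStarAlgAut {n : ℕ} (U : unitary (Matrix (Fin n) (Fin n) ℂ))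
    (X : Matrix (Fin n) (Fin n) ℂ) : (conjStarAlgAut ℂ _ U X).charpoly = X.charpoly := by
  rw [conjStarAlgAut_apply, charpoly_mul_comm, ← mul_assoc, Unitary.coe_star_mul_self, one_mul]

theorem trace_mul_self_eq_sum_eigenvalues {n : ℕ} {ρ : Matrix (Fin n) (Fin n) ℂ}
    (h : ρ.IsHermitian) : (ρ * ρ).trace = ((∑ i, h.eigenvalues i ^ 2 : ℝ) : ℂ) := by
  conv_lhs => rw [h.spectral_theorem, ← map_mul, trace_conjStarAlgAut, Matrix.diagonal_mul_diagonal,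
    Matrix.trace_diagonal]
  simp [pow_two]

theorem sum_eigenvalues_eq_one {n : ℕ} {ρ : Matrix (Fin n) (Fin n) ℂ} (h : IsState ρ) :
    ∑ i, h.1.isHermitian.eigenvalues i = 1 := by
  have := h.2.symm.trans h.1.isHermitian.trace_eq_sum_eigenvalues
  rw [← Complex.ofReal_inj, Complex.ofReal_sum, Complex.ofReal_one]
  exact this.symm

theorem purity_eq_sum_sq {n : ℕ} {ρ : Matrix (Fin n) (Fin n) ℂ} (h : IsState ρ) :
    purity ρ = ∑ i, h.1.isHermitian.eigenvalues i ^ 2 := by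
  have ht : ρ.trace.re = 1 := by rw [h.2, Complex.one_re]
  rw [purity, ht, trace_mul_self_eq_sum_eigenvalues h.1.isHermitian, Complex.ofReal_re, one_pow,
    div_one]

theorem eigenvalues_mem_puritySpectra {n : ℕ} {ρ : Matrix (Fin n) (Fin n) ℂ} (h : IsState ρ) :
    h.1.isHermitian.eigenvalues ∈ puritySpectra n (purity ρ) :=
  ⟨h.1.eigenvalues_nonneg, sum_eigenvalues_eq_one h, (purity_eq_sum_sq h).symm⟩

theorem subentropy_eq_extSubentropy {k : ℕ} {ρ : Matrix (Fin (k + 1)) (Fin (k + 1)) ℂ}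
    (h : IsState ρ) : subentropy ρ = extSubentropy k h.1.isHermitian.eigenvalues := by
  rw [subentropy, dif_pos h.1.isHermitian,
    spectralSubentropy_eq_extSubentropy h.1.eigenvalues_nonneg]

theorem isState_depolarize {n : ℕ} (hn : n ≠ 0) {ε : ℝ} (h0 : 0 ≤ ε) (h1 : ε ≤ 1)
    {φ : Matrix (Fin n) (Fin n) ℂ} (hφ : IsState φ) : IsState (depolarize ε φ) := by
  have hn' : (n : ℂ) ≠ 0 := by exact_mod_cast hn
  refine ⟨?_, ?_⟩
  · rw [depolarize, hφ.2]
    refine (hφ.1.smul (by exact_mod_cast h0)).add (Matrix.PosSemidef.one.smul ?_)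
    rw [mul_one, show (1 - (ε : ℂ)) / (n : ℂ) = (((1 - ε) / n : ℝ) : ℂ) by push_cast; rfl]
    exact_mod_cast div_nonneg (sub_nonneg.2 h1) (Nat.cast_nonneg n)
  · rw [depolarize, hφ.2, Matrix.trace_add, Matrix.trace_smul, Matrix.trace_smul, hφ.2,
      Matrix.trace_one, Fintype.card_fin, smul_eq_mul, smul_eq_mul]
    field_simp
    ring

/-- The rank counts the nonzero eigenvalues; the only one equals the trace. -/
theorem exists_eigenvalues_eq_of_isPureState {n : ℕ} {φ : Matrix (Fin n) (Fin n) ℂ}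
    (h : IsPureState φ) : ∃ i₀, ∀ i,
      h.1.1.isHermitian.eigenvalues i = if i = i₀ then 1 else 0 := by
  have hr := h.2.symm.trans h.1.1.isHermitian.rank_eq_card_non_zero_eigs
  obtain ⟨⟨i₀, hi₀⟩, huniq⟩ := Fintype.card_eq_one_iff.1 hr.symm
  have hz : ∀ i, i ≠ i₀ → h.1.1.isHermitian.eigenvalues i = 0 := by
    intro i hi
    by_contra hne
    exact hi (congrArg Subtype.val (huniq ⟨i, hne⟩))
  refine ⟨i₀, fun i => ?_⟩
  split_ifs with hi
  · rw [hi, ← sum_eigenvalues_eq_one h.1]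
    exact (Fintype.sum_eq_single i₀ hz).symm
  · exact hz i hi

open Polynomial in
theorem charpoly_depolarize {k : ℕ} (P : ℝ) {φ : Matrix (Fin (k + 1)) (Fin (k + 1)) ℂ}
    (h : IsPureState φ) : (depolarize (epsOf (k + 1) P) φ).charpoly =
      (X - C (eigA (k + 1) P : ℂ)) ^ k * (X - C (eigB (k + 1) P : ℂ)) := by
  obtain ⟨i₀, hi₀⟩ := exists_eigenvalues_eq_of_isPureState h
  -- An eigenbasis of φ also diagonalises the depolarized matrix, with entries ε + a = b and a.
  have hD : depolarize (epsOf (k + 1) P) φ =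
      Unitary.conjStarAlgAut ℂ _ h.1.1.isHermitian.eigenvectorUnitary (Matrix.diagonal fun i =>
        if i = i₀ then (eigB (k + 1) P : ℂ) else (eigA (k + 1) P : ℂ)) := by
    have hdiag : (Matrix.diagonal fun i =>
        if i = i₀ then (eigB (k + 1) P : ℂ) else (eigA (k + 1) P : ℂ)) =
        (epsOf (k + 1) P : ℂ) •
          Matrix.diagonal (RCLike.ofReal ∘ h.1.1.isHermitian.eigenvalues) +
        (eigA (k + 1) P : ℂ) • (1 : Matrix (Fin (k + 1)) (Fin (k + 1)) ℂ) := by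
      ext i j
      by_cases hij : i = j
      · subst hij
        by_cases hi : i = i₀ <;> simp [hi₀, hi, eigB_eq]
      · simp [hij]
    rw [hdiag, map_add, map_smul, map_smul, map_one, ← h.1.1.isHermitian.spectral_theorem,
      depolarize, h.1.2, mul_one, eigA]
    push_cast
    rfl
  rw [hD, charpoly_conjStarAlgAut, Matrix.charpoly_diagonal,
    ← Finset.mul_prod_erase Finset.univ _ (Finset.mem_univ i₀), if_pos rfl, mul_comm,
    Finset.prod_congr rfl fun i hi => by rw [if_neg (Finset.ne_of_mem_erase hi)],
    Finset.prod_const, Finset.card_erase_of_mem (Finset.mem_univ i₀)]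
  simp

open Polynomial in
theorem map_eigenvalues_depolarize {k : ℕ} (P : ℝ) {φ : Matrix (Fin (k + 1)) (Fin (k + 1)) ℂ}
    (h : IsPureState φ) (hH : (depolarize (epsOf (k + 1) P) φ).IsHermitian) :
    Finset.univ.val.map hH.eigenvalues = Finset.univ.val.map (extremalSpectrum k P) := by
  have hr := hH.roots_charpoly_eq_eigenvalues
  rw [charpoly_depolarize P h, roots_mul (mul_ne_zero (pow_ne_zero _ (X_sub_C_ne_zero _))
    (X_sub_C_ne_zero _)), roots_pow, roots_X_sub_C, roots_X_sub_C, ← Multiset.map_map] at hr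
  refine Multiset.map_injective Complex.ofReal_injective (hr.symm.trans ?_)
  rw [extremalSpectrum, map_univ_vecCons, Multiset.map_cons, ← Multiset.singleton_add, add_comm]
  simp [Multiset.nsmul_singleton]

theorem exists_isPureState (k : ℕ) : ∃ φ : Matrix (Fin (k + 1)) (Fin (k + 1)) ℂ, IsPureState φ := by
  refine ⟨Matrix.diagonal (Pi.single 0 1), ⟨Matrix.PosSemidef.diagonal ?_, ?_⟩, ?_⟩
  · intro i
    by_cases hi : i = 0
    · subst hi; simp
    · simp [hi]
  · simp [Matrix.trace_diagonal]
  · rw [Matrix.rank_diagonal, Fintype.card_eq_one_iff]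
    refine ⟨⟨0, by simp⟩, fun ⟨i, hi⟩ => Subtype.ext ?_⟩
    by_contra hne
    exact hi (by simpa using Pi.single_eq_of_ne hne 1)

theorem lemma1 (n : ℕ) (hn : 2 ≤ n) :
    -- the limits that define the subentropy exist for every state
    (∀ (ρ : Matrix (Fin n) (Fin n) ℂ) (hρ : IsState ρ),
      Tendsto genericSubentropy (𝓝[genericSpectra n] hρ.1.isHermitian.eigenvalues)
        (𝓝 (subentropy ρ))) ∧
    ∀ P : ℝ, 1 / (n : ℝ) ≤ P → P ≤ 1 →
      -- the maximum at purity `P` is attained by any depolarized pure state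
      (∀ φ : Matrix (Fin n) (Fin n) ℂ, IsPureState φ →
        IsState (depolarize (epsOf n P) φ) ∧
        purity (depolarize (epsOf n P) φ) = P ∧
        (depolarize (epsOf n P) φ).charpoly =
          (Polynomial.X - Polynomial.C (eigA n P : ℂ)) ^ (n - 1) *
            (Polynomial.X - Polynomial.C (eigB n P : ℂ)) ∧
        ∀ ρ : Matrix (Fin n) (Fin n) ℂ, IsState ρ → purity ρ = P →
          subentropy ρ ≤ subentropy (depolarize (epsOf n P) φ)) ∧
      -- the value of the maximum
      (1 / (n : ℝ) < P →
        IsGreatest {q : ℝ | ∃ ρ : Matrix (Fin n) (Fin n) ℂ,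
          IsState ρ ∧ purity ρ = P ∧ subentropy ρ = q} (maxSubentropyFormula n P)) ∧
      -- at `P = 1/n`, where `a = b`, the expression is replaced by its limit
      (P = 1 / (n : ℝ) →
        IsGreatest {q : ℝ | ∃ ρ : Matrix (Fin n) (Fin n) ℂ,
          IsState ρ ∧ purity ρ = P ∧ subentropy ρ = q} (Real.log n - harmonicTail n) ∧
        Tendsto (maxSubentropyFormula n) (𝓝[>] P) (𝓝 (Real.log n - harmonicTail n))) := by
  obtain ⟨k, rfl⟩ : ∃ k, n = k + 1 := ⟨n - 1, by omega⟩
  have hk : 1 ≤ k := by omega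
  refine ⟨fun ρ hρ => ?_, fun P hP hP1 => ?_⟩
  · rw [subentropy_eq_extSubentropy hρ]
    exact tendsto_genericSubentropy _
  have hext := extremalSpectrum_mem hk hP hP1
  have hstate : ∀ φ : Matrix (Fin (k + 1)) (Fin (k + 1)) ℂ, IsPureState φ →
      IsState (depolarize (epsOf (k + 1) P) φ) := fun φ hφ =>
    isState_depolarize (by omega) (Real.sqrt_nonneg _) (epsOf_le_one hn hP1) hφ.1
  have hpure : ∀ φ : Matrix (Fin (k + 1)) (Fin (k + 1)) ℂ, IsPureState φ →
      purity (depolarize (epsOf (k + 1) P) φ) = P ∧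
      subentropy (depolarize (epsOf (k + 1) P) φ) =
        extSubentropy k (extremalSpectrum k P) := fun φ hφ => by
    have hS := hstate φ hφ
    obtain ⟨σ, hσ⟩ := exists_perm_of_map_univ_eq
      (map_eigenvalues_depolarize P hφ hS.1.isHermitian)
    rw [purity_eq_sum_sq hS, subentropy_eq_extSubentropy hS, hσ]
    exact ⟨(comp_equiv_mem_puritySpectra hext σ).2.2, extSubentropy_comp_equiv σ hext.1⟩
  have hle : ∀ ρ : Matrix (Fin (k + 1)) (Fin (k + 1)) ℂ, IsState ρ → purity ρ = P →
      subentropy ρ ≤ extSubentropy k (extremalSpectrum k P) := fun ρ hρ hρP => by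
    rw [subentropy_eq_extSubentropy hρ]
    exact extSubentropy_le_extremal hk (hρP ▸ eigenvalues_mem_puritySpectra hρ)
  have hgreatest : IsGreatest {q : ℝ | ∃ ρ : Matrix (Fin (k + 1)) (Fin (k + 1)) ℂ,
      IsState ρ ∧ purity ρ = P ∧ subentropy ρ = q}
      (extSubentropy k (extremalSpectrum k P)) := by
    refine ⟨?_, ?_⟩
    · obtain ⟨φ, hφ⟩ := exists_isPureState k
      exact ⟨_, hstate φ hφ, hpure φ hφ⟩
    · rintro q ⟨ρ, hρ, hρP, rfl⟩
      exact hle ρ hρ hρP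
  refine ⟨fun φ hφ => ⟨hstate φ hφ, (hpure φ hφ).1, charpoly_depolarize P hφ, ?_⟩,
    fun hlt => ?_, ?_⟩
  · rw [(hpure φ hφ).2]
    exact hle
  · rwa [← extSubentropy_extremal_eq_formula hk hlt hP1]
  · rintro rfl
    rw [← extSubentropy_extremal_of_eq]
    refine ⟨hgreatest, ?_⟩
    -- The expression is singular at a = b, but it agrees on (1/n, 1) with a function of the purity
    -- that is continuous at 1/n.
    refine ((((continuous_extSubentropy k).comp (continuous_extremalSpectrum k)).tendsto
      _).mono_left nhdsWithin_le_nhds).congr' ?_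
    have h1 : 1 / ((k + 1 : ℕ) : ℝ) < 1 := by
      rw [div_lt_one (by positivity)]
      exact_mod_cast hn
    filter_upwards [Ioo_mem_nhdsGT h1] with Q hQ
    exact extSubentropy_extremal_eq_formula hk hQ.1 hQ.2.le
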